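/- **Proposition.** Let $p$ be a prime and let $M$ be an $\omega$-categorical structure (in a countable language) whose theory has NIP. Let $G$ be a $p$-group, i.e. a group in which the order of every element is a power of $p$. Suppose $G$ carries a first-order structure, in some language $L'$, in which the multiplication of $G$ is $\emptyset$-definable and which is interpretable over $\emptyset$ in $M$. (For example, $L'$ is the language of groups and $G$ is any group interpretable over $\emptyset$ in $M$; or $G$ carries the full structure induced from $M$.) Suppose that $G$ is characteristically simple: no proper nontrivial subgroup of $G$ is invariant under all automorphisms of the $L'$-structure $G$. (If $L'$ is the language of groups, this says that $G$ has no proper nontrivial characteristic subgroup.) Let $\mathfrak C$ be an $\aleph_1$-saturated model (for instance a monster model) of the $L'$-theory of $G$, and suppose that there is a complete type $q(x)$ over $\mathfrak C$, in one variable $x$ ranging over the group, which is non-algebraic and generically stable over $\emptyset$. Then $G$ is abelian. Here $q$ is *generically stable over $\emptyset$* if * $q$ is $\emptyset$-invariant: for every formula $\varphi(x,y)$ and all tuples $b,b'$ of $\mathfrak C$ with the same type over $\emptyset$, $\varphi(x,b)\in q$ if and only if $\varphi(x,b')\in q$; and * for every ordinal $\alpha$, every Morley sequence $(a_i)_{i<\alpha}$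 in $q$ over $\emptyset$ (i.e. $a_i\in\mathfrak C$ realizes the restriction of $q$ to $\{a_j : j<i\}$ for each $i<\alpha$) and every formula $\varphi(x)$ with parameters from $\mathfrak C$, the set $\{i<\alpha : \mathfrak C\models\varphi(a_i)\}$ is finite or cofinite in $\alpha$. A theory has *NIP* if there are no formula $\varphi(x,y)$ (with $x,y$ tuples), model $N$ of the theory, and tuples $(a_i)_{i<\omega}$ in $N$ such that for every $w\subseteq\omega$ there is a tuple $b_w$ in $N$ with $N\models\varphi(a_i,b_w)$ exactly when $i\in w$. -/

import Mathlib

open FirstOrder FirstOrder.Language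

universe u v w u' v' w'

namespace OmegaCat

/-- An `L`-structure `M` is `ω`-categorical: the language is countable and any two countably
infinite models of the complete theory of `M` are isomorphic. -/
def IsOmegaCategorical (L : FirstOrder.Language.{u, v}) (M : Type w) [L.Structure M] : Prop :=
  Countable L.Symbols ∧ (Cardinal.aleph0.{w}).Categorical (L.completeTheory M)

/-- The theory of `M` has NIP: in no model `N` of it is there a formula `φ(x, y)` in tuples of
variables `x`, `y` and a sequence `(a i)` of tuples such that every subset of `ℕ` is cut out
by some `φ(_, b)`. -/
def HasNIP (L : FirstOrder.Language.{u, v}) (M : Type w) [L.Structure M] : Prop :=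
  ∀ (N : Type w) [L.Structure N], M ≅[L] N →
    ∀ (m n : ℕ) (φ : L.Formula (Fin m ⊕ Fin n)) (a : ℕ → Fin m → N),
      ¬ ∀ s : Set ℕ, ∃ b : Fin n → N, ∀ i : ℕ, φ.Realize (Sum.elim (a i) b) ↔ i ∈ s

/-- The preimage of `S ⊆ G ^ k` under the `k`-th power of a map `f : D → G`,
where `D ⊆ M ^ n`. -/
def pullback {M : Type w} {G : Type w'} {n : ℕ} {D : Set (Fin n → M)} (f : D → G) {k : ℕ}
    (S : Set (Fin k → G)) : Set (Fin k × Fin n → M) :=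
  {x | ∃ h : ∀ i, (fun j => x (i, j)) ∈ D, (fun i => f ⟨fun j => x (i, j), h i⟩) ∈ S}

/-- The `L'`-structure `G` is interpretable over `∅` in the `L`-structure `M`: there are a subset
`D` of some `M ^ n` and a surjection `f : D → G` such that the preimage of every `∅`-definable
subset of a power of `G` is `∅`-definable in `M`. (Applied to `G` itself and to the
diagonal of `G ^ 2`, this says that `D` and the kernel of `f` are `∅`-definable.) -/
def IsInterpretable (L : FirstOrder.Language.{u, v}) (M : Type w) [L.Structure M]
    (L' : FirstOrder.Language.{u', v'}) (G : Type w') [L'.Structure G] : Prop :=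
  ∃ (n : ℕ) (D : Set (Fin n → M)) (f : D → G), Function.Surjective f ∧
    ∀ (k : ℕ) (S : Set (Fin k → G)),
      (∅ : Set G).Definable L' S → (∅ : Set M).Definable L (pullback f S)

/-- A group `G` carrying an `L`-structure is characteristically simple: the only subgroups invariant
under all automorphisms of the structure are the trivial subgroup and `G`. When the automorphisms
of the structure are those of the group (for instance for a group considered in the language of
groups) this is the usual notion of group theory. -/
def IsCharacteristicallySimple (L : FirstOrder.Language.{u, v}) (G : Type w) [Group G] [L.Structure G] :
    Prop :=
  ∀ H : Subgroup G, (∀ σ : G ≃[L] G, ∀ x ∈ H, σ x ∈ H) → H = ⊥ ∨ H = ⊤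

/-- `C` is `ℵ₁`-saturated: every finitely satisfiable set of formulas in one variable over a
countable set of parameters is realized. -/
def IsAlephOneSaturated (L : FirstOrder.Language.{u, v}) (C : Type w) [L.Structure C] : Prop :=
  ∀ A : Set C, A.Countable → ∀ Γ : Set (L[[A]].Formula Unit),
    (∀ Γ₀ : Set (L[[A]].Formula Unit), Γ₀ ⊆ Γ → Γ₀.Finite →
      ∃ c : C, ∀ φ ∈ Γ₀, φ.Realize (fun _ => c)) →
    ∃ c : C, ∀ φ ∈ Γ, φ.Realize (fun _ => c)

/-- The space `S₁(C)` of complete types in one variable over `C`. -/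
abbrev GlobalType (L : FirstOrder.Language.{u, v}) (C : Type w) [L.Structure C] :=
  (L.elementaryDiagram C).CompleteType Unit

namespace GlobalType

variable {L : FirstOrder.Language.{u, v}} {C : Type w} [L.Structure C]

/-- The formula `φ(b, x)` with parameters `b` belongs to the global type `q(x)`. -/
def Contains (q : GlobalType L C) {m : ℕ} (φ : L.Formula (Fin m ⊕ Unit)) (b : Fin m → C) : Prop :=
  Formula.equivSentence
    (BoundedFormula.constantsVarsEquiv.symm (φ.relabel (Sum.map b id)) : L[[C]].Formula Unit) ∈ q

/-- `q` is non-algebraic: every formula in `q` has infinitely many realizations. -/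
def IsNonAlgebraic (q : GlobalType L C) : Prop :=
  ∀ (m : ℕ) (φ : L.Formula (Fin m ⊕ Unit)) (b : Fin m → C), q.Contains φ b →
    {c : C | φ.Realize (Sum.elim b fun _ => c)}.Infinite

/-- `c` realizes the restriction of `q` to the set of parameters `B`. -/
def RealizesOver (q : GlobalType L C) (B : Set C) (c : C) : Prop :=
  ∀ (m : ℕ) (φ : L.Formula (Fin m ⊕ Unit)) (b : Fin m → C), (∀ i, b i ∈ B) →
    q.Contains φ b → φ.Realize (Sum.elim b fun _ => c)

/-- `q` is `A`-invariant: whether `φ(b, x)` is in `q` depends only on `φ` and `tp(b / A)`. -/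
def IsInvariantOver (q : GlobalType L C) (A : Set C) : Prop :=
  ∀ (m : ℕ) (b b' : Fin m → C),
    (∀ ψ : L[[A]].Formula (Fin m), ψ.Realize b ↔ ψ.Realize b') →
    ∀ φ : L.Formula (Fin m ⊕ Unit), q.Contains φ b ↔ q.Contains φ b'

/-- `(a i)` is a Morley sequence in `q` over `A`, indexed by a well-ordered set. -/
def IsMorleySequence (q : GlobalType L C) (A : Set C) {ι : Type} [LinearOrder ι] (a : ι → C) :
    Prop :=
  ∀ i : ι, q.RealizesOver (A ∪ a '' Set.Iio i) (a i)

/-- `q` is generically stable over `A`: it is `A`-invariant, and along any Morley sequence in `q`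
over `A`, of any ordinal length, every formula with parameters from `C` holds finitely or cofinitely
often. -/
def IsGenericallyStableOver (q : GlobalType L C) (A : Set C) : Prop :=
  q.IsInvariantOver A ∧
    ∀ (ι : Type) [LinearOrder ι] [WellFoundedLT ι] (a : ι → C), q.IsMorleySequence A a →
      ∀ (m : ℕ) (φ : L.Formula (Fin m ⊕ Unit)) (b : Fin m → C),
        {i : ι | φ.Realize (Sum.elim b fun _ => a i)}.Finite ∨
          {i : ι | ¬ φ.Realize (Sum.elim b fun _ => a i)}.Finite

end GlobalType

end OmegaCat

namespace OmegaCat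

section OmittingTypes

variable {L : FirstOrder.Language.{u, v}}

theorem realize_congr {N : Type*} [L.Structure N] {α : Type*} [DecidableEq α] {φ : L.Formula α}
    {x y : α → N} (h : ∀ a ∈ φ.freeVarFinset, x a = y a) : φ.Realize x ↔ φ.Realize y := by
  have h1 := BoundedFormula.realize_restrictFreeVar (φ := φ) (f := id)
    (v := fun a => x a) (xs := (default : Fin 0 → N)) x (by simp)
  have h2 := BoundedFormula.realize_restrictFreeVar (φ := φ) (f := id)
    (v := fun a => x a) (xs := (default : Fin 0 → N)) y (by simpa using h)
  exact h1.symm.trans h2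

theorem countable_formula (hL : Countable L.Symbols) (α : Type) [Countable α] :
    Countable (L.Formula α) := by
  have h : Cardinal.mk (Σ n, L.BoundedFormula α n) ≤ Cardinal.aleph0 := by
    refine BoundedFormula.card_le.trans (max_le le_rfl ?_)
    have hc : L.card ≤ Cardinal.aleph0 := Cardinal.mk_le_aleph0_iff.2 hL
    have ha : Cardinal.mk α ≤ Cardinal.aleph0 := Cardinal.mk_le_aleph0_iff.2 inferInstance
    refine Cardinal.add_le_aleph0.2 ⟨by simp, by simpa⟩
  have := Cardinal.mk_le_aleph0_iff.1 h
  exact Function.Injective.countable (f := fun φ : L.Formula α => (⟨0, φ⟩ : Σ n, L.BoundedFormula α n))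
    (fun _ _ h => by simpa using h)

/-- The tuple `x` of elements of `N` realizes the complete type `P`. -/
def IsRealizedBy {T : L.Theory} {α : Type} (P : T.CompleteType α) {N : Type*} [L.Structure N]
    (x : α → N) : Prop :=
  ∀ φ : L.Formula α, Formula.equivSentence φ ∈ P ↔ φ.Realize x

variable {T : L.Theory}

theorem exists_isRealizedBy {α : Type} (P : T.CompleteType α) :
    ∃ (N : Theory.ModelType.{u, v, max u v} T) (x : α → N), IsRealizedBy P x := by
  obtain ⟨N, x, rfl⟩ := Theory.exists_modelType_is_realized_in _ P
  exact ⟨N, x, fun φ => Theory.CompleteType.formula_mem_typeOf⟩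

theorem isRealizedBy_typeOf {α : Type} {N : Type*} [L.Structure N] [Nonempty N] [N ⊨ T]
    (x : α → N) : IsRealizedBy (T.typeOf x) x :=
  fun _ => Theory.CompleteType.formula_mem_typeOf

theorem IsRealizedBy.ext {α : Type} {P Q : T.CompleteType α} {N : Type*} [L.Structure N]
    {x : α → N} (hP : IsRealizedBy P x) (hQ : IsRealizedBy Q x) : P = Q := by
  refine SetLike.ext fun φ => ?_
  obtain ⟨φ, rfl⟩ := Formula.equivSentence.surjective φ
  rw [hP φ, hQ φ]

theorem IsRealizedBy.of_forall {α : Type} {P : T.CompleteType α} {N : Type*} [L.Structure N]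
    {x : α → N} (h : ∀ φ : L.Formula α, Formula.equivSentence φ ∈ P → φ.Realize x) :
    IsRealizedBy P x := by
  refine fun φ => ⟨h φ, fun hx => ?_⟩
  refine (P.mem_or_not_mem _).resolve_right fun hn => ?_
  exact Formula.realize_not.1 (h φ.not hn) hx

/-- The types over `T` in variables `ℕ` for which a given existential statement has a witness
among the variables. -/
def witnessed (T : L.Theory) (φ : L.Formula (ℕ ⊕ Unit)) : Set (T.CompleteType ℕ) :=
  {P | Formula.equivSentence (φ.iExs Unit) ∈ P →
    ∃ m : ℕ, Formula.equivSentence (φ.relabel (Sum.elim id fun _ => m)) ∈ P}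

theorem isOpen_setOf_mem {α : Type} (φ : L[[α]].Sentence) : IsOpen {P : T.CompleteType α | φ ∈ P} :=
  CompleteType.isOpen_typesWith φ

theorem isOpen_setOf_notMem {α : Type} (φ : L[[α]].Sentence) :
    IsOpen {P : T.CompleteType α | φ ∉ P} :=
  (CompleteType.isClosed_typesWith φ).isOpen_compl

theorem isOpen_witnessed (φ : L.Formula (ℕ ⊕ Unit)) : IsOpen (witnessed T φ) := by
  have : witnessed T φ = {P | Formula.equivSentence (φ.iExs Unit) ∉ P} ∪
      ⋃ m : ℕ, {P | Formula.equivSentence (φ.relabel (Sum.elim id fun _ => m)) ∈ P} := by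
    ext P
    simp [witnessed, imp_iff_not_or]
  rw [this]
  exact (isOpen_setOf_notMem _).union (isOpen_iUnion fun m => isOpen_setOf_mem _)

theorem dense_of_forall_formula {s : Set (T.CompleteType ℕ)}
    (h : ∀ (χ : L.Formula ℕ) (N : Theory.ModelType.{u, v, max u v} T) (x : ℕ → N), χ.Realize x →
      ∃ P ∈ s, Formula.equivSentence χ ∈ P) : Dense s := by
  rw [CompleteType.isTopologicalBasis_range_typesWith.dense_iff]
  rintro _ ⟨χ, rfl⟩ ⟨P, hP⟩
  obtain ⟨χ, rfl⟩ := Formula.equivSentence.surjective χ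
  obtain ⟨N, x, hx⟩ := exists_isRealizedBy P
  obtain ⟨Q, hQ, hχ⟩ := h χ N x ((hx χ).1 hP)
  exact ⟨Q, hχ, hQ⟩

theorem dense_witnessed (φ : L.Formula (ℕ ⊕ Unit)) : Dense (witnessed T φ) := by
  refine dense_of_forall_formula fun χ N x hχ => ?_
  by_cases hex : (φ.iExs Unit).Realize x
  · obtain ⟨y, hy⟩ := Formula.realize_iExs.1 hex
    obtain ⟨m, hm⟩ := Infinite.exists_notMem_finset
      (χ.freeVarFinset ∪ φ.freeVarFinset.toLeft)
    simp only [Finset.mem_union, Finset.mem_toLeft, not_or] at hm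
    set x' := Function.update x m (y ()) with hx'
    have hne : ∀ a, a ≠ m → x' a = x a := fun a ha => Function.update_of_ne ha _ _
    refine ⟨T.typeOf x', fun _ => ⟨m, ?_⟩, ?_⟩
    · rw [Theory.CompleteType.formula_mem_typeOf, Formula.realize_relabel]
      refine (realize_congr ?_).1 hy
      rintro (a | a) ha
      · exact (hne a fun h => hm.2 (h ▸ ha)).symm
      · simp [hx']
    · rw [Theory.CompleteType.formula_mem_typeOf]
      exact (realize_congr fun a ha => (hne a fun h => hm.1 (h ▸ ha)).symm).1 hχ
  · exact ⟨T.typeOf x, fun h => absurd (Theory.CompleteType.formula_mem_typeOf.1 h) hex,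
      Theory.CompleteType.formula_mem_typeOf.2 hχ⟩

/-- The types over `T` in variables `ℕ` whose restriction to the tuple `s` is not `p`. -/
def omitted {n : ℕ} (p : T.CompleteType (Fin n)) (s : Fin n → ℕ) : Set (T.CompleteType ℕ) :=
  {P | ∃ φ : L.Formula (Fin n), Formula.equivSentence φ ∈ p ∧
    Formula.equivSentence (φ.relabel s) ∉ P}

theorem isOpen_omitted {n : ℕ} (p : T.CompleteType (Fin n)) (s : Fin n → ℕ) :
    IsOpen (omitted p s) := by
  have : omitted p s = ⋃ (φ : L.Formula (Fin n)) (_ : Formula.equivSentence φ ∈ p),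
      {P | Formula.equivSentence (φ.relabel s) ∉ P} := by
    ext P
    simp [omitted]
  rw [this]
  exact isOpen_iUnion fun φ => isOpen_iUnion fun _ => isOpen_setOf_notMem _

theorem notMem_omitted {n : ℕ} {p : T.CompleteType (Fin n)} {s : Fin n → ℕ} {N : Type*}
    [L.Structure N] {P : T.CompleteType ℕ} {x : ℕ → N} (hx : IsRealizedBy P x) :
    P ∉ omitted p s ↔ IsRealizedBy p (x ∘ s) := by
  refine ⟨fun h => .of_forall fun φ hφ => ?_, fun h => ?_⟩
  · by_contra hn
    refine h ⟨φ, hφ, fun hm => hn ?_⟩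
    exact Formula.realize_relabel.1 ((hx _).1 hm)
  · rintro ⟨φ, hφ, hP⟩
    exact hP ((hx _).2 (Formula.realize_relabel.2 ((h φ).1 hφ)))

theorem dense_omitted {n : ℕ} {p : T.CompleteType (Fin n)} (hp : ¬ IsOpen {p}) (s : Fin n → ℕ) :
    Dense (omitted p s) := by
  classical
  refine dense_of_forall_formula fun χ N x hχ => ?_
  by_contra! hcon
  obtain ⟨k, hk⟩ : ∃ k, ∀ a ∈ χ.freeVarFinset ∪ Finset.univ.image s, a < k :=
    ⟨(χ.freeVarFinset ∪ Finset.univ.image s).sup id + 1,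
      fun a ha => Nat.lt_succ_of_le (Finset.le_sup (f := id) ha)⟩
  have hs : ∀ i, s i < k := fun i => hk _ (by simp)
  -- `p` is isolated by the formula "some realization of `χ` extends the given tuple along `s`"
  let ψ : L.Formula (Fin n ⊕ Fin (k + 1)) :=
    χ.relabel (fun a => Sum.inr (if h : a < k then ⟨a, by omega⟩ else Fin.last k)) ⊓
      Formula.iInf fun i : Fin n =>
        Term.equal (Term.var (Sum.inl i)) (Term.var (Sum.inr ⟨s i, (hs i).trans (Nat.lt_succ_self k)⟩))
  have hψ : ∀ {N' : Theory.ModelType.{u, v, max u v} T} (y : Fin n → N'),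
      (ψ.iExs (Fin (k + 1))).Realize y ↔ ∃ z : ℕ → N', χ.Realize z ∧ z ∘ s = y := by
    intro N' y
    rw [Formula.realize_iExs]
    constructor
    · rintro ⟨z, hz⟩
      rw [Formula.realize_inf, Formula.realize_relabel, Formula.realize_iInf] at hz
      refine ⟨_, hz.1, funext fun i => ?_⟩
      have := hz.2 i
      simp only [Formula.realize_equal, Term.realize_var, Sum.elim_inl, Sum.elim_inr] at this
      simp [hs i, this]
    · rintro ⟨z, hz, rfl⟩
      refine ⟨fun a => z a, ?_⟩
      rw [Formula.realize_inf, Formula.realize_relabel, Formula.realize_iInf]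
      refine ⟨(realize_congr fun a ha => ?_).1 hz, fun i => ?_⟩
      · have : a < k := hk _ (by simp [ha])
        simp [this]
      · simp [Formula.realize_equal]
  have key : ∀ {N' : Theory.ModelType.{u, v, max u v} T} (z : ℕ → N'), χ.Realize z →
      IsRealizedBy p (z ∘ s) := fun z hz =>
    (notMem_omitted (isRealizedBy_typeOf z)).1 fun h =>
      hcon _ h (Theory.CompleteType.formula_mem_typeOf.2 hz)
  apply hp
  have : {p} = {q : T.CompleteType (Fin n) | Formula.equivSentence (ψ.iExs (Fin (k + 1))) ∈ q} := by
    ext q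
    simp only [Set.mem_singleton_iff, Set.mem_ofPred_eq]
    constructor
    · rintro rfl
      exact (key x hχ _).2 ((hψ _).2 ⟨x, hχ, rfl⟩)
    · intro hq
      obtain ⟨N', y, hy⟩ := exists_isRealizedBy q
      obtain ⟨z, hz, rfl⟩ := (hψ y).1 ((hy _).1 hq)
      exact hy.ext (key z hz)
  rw [this]
  exact isOpen_setOf_mem _

/-- The omitting types theorem for a single type. -/
theorem exists_countable_model_omitting (hL : Countable L.Symbols) (hT : T.IsSatisfiable) {n : ℕ}
    {p : T.CompleteType (Fin n)} (hp : ¬ IsOpen {p}) :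
    ∃ N : Theory.ModelType.{u, v, max u v} T, Countable N ∧ ∀ x : Fin n → N, ¬ IsRealizedBy p x := by
  have := countable_formula hL (ℕ ⊕ Unit)
  have : Nonempty (T.CompleteType ℕ) := Theory.CompleteType.nonempty_iff.2 hT
  have hd : Dense ((⋂ φ, witnessed T φ) ∩ ⋂ s, omitted p s) := by
    refine Dense.inter_of_Gδ (.iInter_of_isOpen isOpen_witnessed)
      (.iInter_of_isOpen (isOpen_omitted p))
      (dense_iInter_of_isOpen isOpen_witnessed dense_witnessed)
      (dense_iInter_of_isOpen (isOpen_omitted p) (dense_omitted hp))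
  obtain ⟨P, hPw, hPo⟩ := hd.nonempty
  rw [Set.mem_iInter] at hPw hPo
  obtain ⟨N, x, hx⟩ := exists_isRealizedBy P
  have hmeet : L.MeetsDefinable (Set.range x) := by
    rintro D ⟨d, hd⟩ hD
    obtain ⟨φ, hφ⟩ := Set.definable_iff_exists_formula_sum.1 hD
    choose i hi using fun a : Set.range x => a.2
    let φ' : L.Formula (ℕ ⊕ Unit) := φ.relabel (Sum.map i fun _ => ())
    have hφ' : ∀ y : Unit → N, φ'.Realize (Sum.elim x y) ↔ y () ∈ D := by
      intro y
      have hy : (fun _ => y () : Fin 1 → N) ∈ {v : Fin 1 → N | v 0 ∈ D} ↔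
        φ.Realize (Sum.elim (↑) fun _ => y ()) := Set.ext_iff.1 hφ _
      rw [Formula.realize_relabel]
      refine Iff.trans ?_ hy.symm
      refine iff_of_eq (congrArg φ.Realize ?_)
      funext a
      rcases a with a | a
      · exact hi a
      · rfl
    have h1 : (φ'.iExs Unit).Realize x := Formula.realize_iExs.2 ⟨fun _ => d, (hφ' _).2 hd⟩
    obtain ⟨m, hm⟩ := hPw φ' ((hx _).2 h1)
    refine ⟨x m, (hφ' fun _ => x m).1 ?_, m, rfl⟩
    have := Formula.realize_relabel.1 ((hx _).1 hm)
    convert! this using 1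
    funext a
    rcases a with a | a <;> rfl
  let S := hmeet.toElementarySubstructure
  have hSx : (S : Set N) = Set.range x := hmeet.closure_eq_self
  have hcS : Countable S := by
    have : ((S : Set N)).Countable := hSx ▸ Set.countable_range x
    exact this.to_subtype
  refine ⟨S.toModel T, hcS, fun y hy => ?_⟩
  have hsurj : ∀ j, ∃ m, x m = (S.subtype (y j) : N) := fun j => by
    have : (S.subtype (y j) : N) ∈ (S : Set N) := (y j).2
    rwa [hSx] at this
  choose s hs using hsurj
  refine (notMem_omitted (p := p) (s := s) hx).2 (fun φ => ?_) (hPo s)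
  rw [hy φ, show x ∘ s = fun j => S.subtype (y j) from funext hs]
  exact (S.subtype.map_formula φ y).symm

end OmittingTypes

section RyllNardzewski

variable {L : FirstOrder.Language.{u, v}}

theorem exists_modelType_equiv {T : L.Theory} (N : Theory.ModelType.{u, v, w'} T) [Countable N] :
    ∃ N' : Theory.ModelType.{u, v, w} T, Nonempty (N ≃[L] N') :=
  have : Small.{w} N := Countable.toSmall N
  ⟨N.shrink, ⟨(equivShrink N).inducedStructureEquiv⟩⟩

theorem IsRealizedBy.map_equiv {T : L.Theory} {α : Type} {P : T.CompleteType α} {N N' : Type*}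
    [L.Structure N] [L.Structure N'] {x : α → N} (h : IsRealizedBy P x) (e : N ≃[L] N') :
    IsRealizedBy P (e ∘ x) := fun φ => by
  rw [h φ, StrongHomClass.realize_formula]

theorem exists_countable_model_realizing (hL : Countable L.Symbols) {T : L.Theory}
    (hinf : ∀ N : Theory.ModelType.{u, v, max u v} T, Infinite N) {n : ℕ}
    (p : T.CompleteType (Fin n)) :
    ∃ N : Theory.ModelType.{u, v, max u v} T, Countable N ∧ ∃ x : Fin n → N, IsRealizedBy p x := by
  obtain ⟨N, x, hx⟩ := exists_isRealizedBy p
  have := hinf N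
  obtain ⟨S, hS, hcard⟩ := exists_elementarySubstructure_card_eq L (Set.range x)
    Cardinal.aleph0.{0} le_rfl
    (by simp)
    (by
      simp only [Cardinal.lift_aleph0, Cardinal.lift_le_aleph0]
      exact Cardinal.mk_le_aleph0_iff.2 hL)
    (by simp)
  have hc : Countable S := by
    rw [← Cardinal.mk_le_aleph0_iff]
    simpa using hcard.le
  refine ⟨S.toModel T, hc, fun i => (⟨x i, hS ⟨i, rfl⟩⟩ : S), fun φ => ?_⟩
  rw [hx φ]
  exact S.subtype.map_formula φ (fun i => (⟨x i, hS ⟨i, rfl⟩⟩ : S))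

/-- Over an `ω`-categorical structure, there are only finitely many `∅`-definable sets in
each finite number of variables. -/
theorem IsOmegaCategorical.finite_definable {M : Type w} [L.Structure M]
    (hcat : IsOmegaCategorical L M) (n : ℕ) :
    {S : Set (Fin n → M) | (∅ : Set M).Definable L S}.Finite := by
  rcases finite_or_infinite M with hM | hM
  · exact Set.toFinite _
  set T := L.completeTheory M with hT
  have hsat : T.IsSatisfiable := completeTheory.isSatisfiable L M
  have hequiv : ∀ (N : Type (max u v)) [L.Structure N] [N ⊨ T] [Nonempty N], N ≅[L] M := by
    intro N _ _ _
    exact (completeTheory.isMaximal L M).isComplete.models_elementarily_equivalent N M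
  have hinf : ∀ N : Theory.ModelType.{u, v, max u v} T, Infinite N := fun N =>
    (hequiv N).infinite_iff.2 hM
  have hopen : ∀ p : T.CompleteType (Fin n), IsOpen {p} := by
    intro p
    by_contra hp
    obtain ⟨N₁, hc₁, x, hx⟩ := exists_countable_model_realizing hcat.1 hinf p
    obtain ⟨N₂, hc₂, hN₂⟩ := exists_countable_model_omitting hcat.1 hsat hp
    obtain ⟨N₁', ⟨e₁⟩⟩ := exists_modelType_equiv.{u, v, w} N₁
    obtain ⟨N₂', ⟨e₂⟩⟩ := exists_modelType_equiv.{u, v, w} N₂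
    have card : ∀ (N : Theory.ModelType.{u, v, max u v} T) (N' : Theory.ModelType.{u, v, w} T),
        Countable N → Nonempty (N ≃[L] N') → Cardinal.mk N' = Cardinal.aleph0 := by
      intro N N' hN ⟨e⟩
      have := hinf N
      have : Infinite N' := e.toEquiv.infinite_iff.1 (hinf N)
      have : Countable N' := e.toEquiv.countable_iff.1 hN
      exact Cardinal.mk_eq_aleph0 N'
    obtain ⟨e⟩ := hcat.2 N₁' N₂' (card _ _ hc₁ ⟨e₁⟩) (card _ _ hc₂ ⟨e₂⟩)
    exact hN₂ _ (((hx.map_equiv e₁).map_equiv e).map_equiv e₂.symm)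
  have : DiscreteTopology (T.CompleteType (Fin n)) := discreteTopology_iff_isOpen_singleton.2 hopen
  have : Finite (T.CompleteType (Fin n)) := finite_of_compact_of_discrete
  choose φ hφ using fun S : {S : Set (Fin n → M) | (∅ : Set M).Definable L S} =>
    Set.empty_definable_iff.1 S.2
  refine Set.finite_coe_iff.1 ?_
  refine Finite.of_injective
    (fun S => {p : T.CompleteType (Fin n) | Formula.equivSentence (φ S) ∈ p}) fun S S' h => ?_
  refine Subtype.ext (Set.ext fun x => ?_)
  rw [hφ S, hφ S']
  have hx := isRealizedBy_typeOf (T := T) x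
  exact (hx _).symm.trans ((Set.ext_iff.1 h (T.typeOf x)).trans (hx _))

theorem finite_definable_of_finite {M : Type w} [L.Structure M]
    (h : ∀ n : ℕ, {S : Set (Fin n → M) | (∅ : Set M).Definable L S}.Finite)
    (α : Type) [Finite α] : {S : Set (α → M) | (∅ : Set M).Definable L S}.Finite := by
  obtain ⟨n, ⟨e⟩⟩ := Finite.exists_equiv_fin α
  refine Set.Finite.of_injOn (f := fun S => (fun y : Fin n → M => y ∘ e) ⁻¹' S)
    (fun S hS => Set.Definable.preimage_comp e hS) ?_ (h n)
  refine Function.Injective.injOn (Function.Surjective.preimage_injective fun y => ⟨y ∘ e.symm, ?_⟩)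
  funext i
  simp

theorem pullback_injective {M : Type w} {G : Type w'} {n : ℕ} {D : Set (Fin n → M)} {f : D → G}
    (hf : Function.Surjective f) (k : ℕ) :
    Function.Injective fun S : Set (Fin k → G) => pullback f S := by
  have hmem : ∀ (S : Set (Fin k → G)) (d : Fin k → D),
      (fun ij : Fin k × Fin n => (d ij.1).1 ij.2) ∈ pullback f S ↔ f ∘ d ∈ S := fun S d =>
    ⟨fun ⟨_, h⟩ => h, fun h => ⟨fun i => (d i).2, h⟩⟩
  intro S S' h
  ext y
  choose d hd using fun i => hf (y i)
  obtain rfl : f ∘ d = y := funext hd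
  rw [← hmem, ← hmem]
  exact Set.ext_iff.1 h _

theorem IsInterpretable.finite_definable {M : Type w} [L.Structure M]
    {L' : FirstOrder.Language.{u', v'}} {G : Type w'} [L'.Structure G]
    (hint : IsInterpretable L M L' G)
    (h : ∀ n : ℕ, {S : Set (Fin n → M) | (∅ : Set M).Definable L S}.Finite) (k : ℕ) :
    {S : Set (Fin k → G) | (∅ : Set G).Definable L' S}.Finite := by
  obtain ⟨n, D, f, hf, hdef⟩ := hint
  exact Set.Finite.of_injOn (f := fun S => pullback f S) (fun S hS => hdef k S hS) (pullback_injective hf k).injOn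
    (finite_definable_of_finite h (Fin k × Fin n))

end RyllNardzewski

section LocallyFinite

variable {L : FirstOrder.Language.{u, v}} {G : Type w} [Group G] [L.Structure G]

theorem definable_lift_eq (hmul : (∅ : Set G).Definable L {x : Fin 3 → G | x 0 * x 1 = x 2})
    (α : Type) (t : FreeGroup α) :
    (∅ : Set G).Definable L
      {y : α ⊕ Unit → G | FreeGroup.lift (fun i => y (Sum.inl i)) t = y (Sum.inr ())} := by
  induction t using FreeGroup.induction_on with
  | C1 =>
    convert! hmul.preimage_comp (β := α ⊕ Unit) (fun _ => Sum.inr ()) using 1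
    ext y
    simp [eq_comm]
  | of i =>
    refine ⟨Term.equal (Term.var (Sum.inl i)) (Term.var (Sum.inr ())), ?_⟩
    ext y
    simp [Formula.realize_equal]
  | inv_of i _ =>
    have h := ((hmul.preimage_comp (β := (α ⊕ Unit) ⊕ Unit)
      ![Sum.inr (), Sum.inr (), Sum.inr ()]).inter (hmul.preimage_comp
        ![Sum.inl (Sum.inl i), Sum.inl (Sum.inr ()), Sum.inr ()])).exists_of_finite
    convert! h using 1
    ext y
    simp only [map_inv, FreeGroup.lift_apply_of, inv_eq_iff_mul_eq_one]
    refine ⟨fun h => ⟨fun _ => 1, by simp, by simpa using h⟩, ?_⟩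
    rintro ⟨z, hz, h⟩
    have hz : z () = 1 := by simpa using hz
    simpa [hz] using h
  | mul s t hs ht =>
    have h := ((hmul.preimage_comp (β := (α ⊕ Unit) ⊕ Fin 2)
      ![Sum.inr 0, Sum.inr 1, Sum.inl (Sum.inr ())]).inter
        ((hs.preimage_comp (Sum.elim (fun i => Sum.inl (Sum.inl i)) fun _ => Sum.inr 0)).inter
        (ht.preimage_comp (Sum.elim (fun i => Sum.inl (Sum.inl i)) fun _ => Sum.inr 1)))
        ).exists_of_finite
    convert! h using 1
    ext y
    simp only [Set.mem_ofPred_eq, map_mul]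
    constructor
    · intro h
      refine ⟨![FreeGroup.lift (fun i => y (Sum.inl i)) s, FreeGroup.lift (fun i => y (Sum.inl i)) t],
        ?_, ?_, ?_⟩
      · simpa using h
      · simp
      · simp
    · rintro ⟨z, h0, h1, h2⟩
      simp only [Set.mem_preimage, Set.mem_ofPred_eq, Function.comp_apply, Sum.elim_inl,
        Sum.elim_inr] at h0 h1 h2
      rw [h1, h2]
      simpa using h0

/-- If there are only finitely many `∅`-definable relations of each arity, then the group is locally
finite. -/
theorem finite_closure_of_finite_definable
    (hmul : (∅ : Set G).Definable L {x : Fin 3 → G | x 0 * x 1 = x 2})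
    (hfin : ∀ n : ℕ, {S : Set (Fin n → G) | (∅ : Set G).Definable L S}.Finite)
    {s : Set G} (hs : s.Finite) : (Subgroup.closure s : Set G).Finite := by
  obtain ⟨n, x, rfl⟩ : ∃ (n : ℕ) (x : Fin n → G), Set.range x = s := by
    have := hs.to_subtype
    obtain ⟨n, ⟨e⟩⟩ := Finite.exists_equiv_fin s
    exact ⟨n, fun i => e.symm i, by rw [Set.range_comp' Subtype.val]; simp⟩
  rw [← FreeGroup.range_lift_eq_closure, MonoidHom.coe_range]
  set D : FreeGroup (Fin n) → Set (Fin n ⊕ Unit → G) := fun t =>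
    {y | FreeGroup.lift (fun i => y (Sum.inl i)) t = y (Sum.inr ())} with hD
  have hDfin : (Set.range D).Finite := (finite_definable_of_finite hfin (Fin n ⊕ Unit)).subset
    (Set.range_subset_iff.2 (definable_lift_eq hmul (Fin n)))
  have hval : ∀ t t', D t = D t' → FreeGroup.lift x t = FreeGroup.lift x t' := by
    intro t t' h
    have : Sum.elim x (fun _ => FreeGroup.lift x t) ∈ D t' := by
      rw [← h]
      simp [hD]
    simpa [hD, eq_comm] using this
  have := hDfin.to_subtype
  rw [← Set.finite_coe_iff]
  refine Finite.of_surjective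
    (fun S : Set.range D => (⟨FreeGroup.lift x S.2.choose, _, rfl⟩ : Set.range (FreeGroup.lift x))) ?_
  rintro ⟨_, t, rfl⟩
  refine ⟨⟨D t, t, rfl⟩, Subtype.ext (hval _ _ ?_)⟩
  exact (⟨t, rfl⟩ : ∃ t', D t' = D t).choose_spec

end LocallyFinite

section PGroups

variable {G : Type w} [Group G] {p : ℕ}

theorem exists_ne_one_forall_commute_of_locallyFinite [Fact p.Prime] (hG : IsPGroup p G)
    [Nontrivial G] (hlf : ∀ s : Set G, s.Finite → (Subgroup.closure s : Set G).Finite)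
    {s : Set G} (hs : s.Finite) : ∃ g : G, g ≠ 1 ∧ ∀ x ∈ s, x * g = g * x := by
  set K := Subgroup.closure s
  have : Finite K := (hlf s hs).to_subtype
  rcases subsingleton_or_nontrivial K with hK | hK
  · obtain ⟨g, hg⟩ := exists_ne (1 : G)
    refine ⟨g, hg, fun x hx => ?_⟩
    have : (⟨x, Subgroup.subset_closure hx⟩ : K) = 1 := Subsingleton.elim _ _
    rw [show x = 1 from congrArg Subtype.val this, one_mul, mul_one]
  · have : Nontrivial (Subgroup.center K) := (hG.to_subgroup K).center_nontrivial
    obtain ⟨g, hg⟩ := exists_ne (1 : Subgroup.center K)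
    refine ⟨g.1, fun h => hg (Subtype.ext (Subtype.ext h)), fun x hx => ?_⟩
    exact congrArg Subtype.val (Subgroup.mem_center_iff.1 g.2 ⟨x, Subgroup.subset_closure hx⟩)

theorem finite_conjugatesOf {g : G} (h : (Subgroup.centralizer {g}).FiniteIndex) :
    (conjugatesOf g).Finite := by
  have : Finite (G ⧸ Subgroup.centralizer {g}) := Subgroup.finite_quotient_of_finiteIndex
  have hr : conjugatesOf g = Set.range fun x : G => x * g * x⁻¹ := by
    ext y
    simp [conjugatesOf, isConj_iff]
  have hq : (fun x : G => x * g * x⁻¹) = Quotient.lift (s := QuotientGroup.leftRel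
      (Subgroup.centralizer {g})) (fun x : G => x * g * x⁻¹) (fun x y hxy => by
        have := QuotientGroup.leftRel_apply.1 hxy
        rw [Subgroup.mem_centralizer_singleton_iff] at this
        calc x * g * x⁻¹ = x * (g * (x⁻¹ * y)) * y⁻¹ := by group
          _ = x * ((x⁻¹ * y) * g) * y⁻¹ := by rw [this]
          _ = y * g * y⁻¹ := by group) ∘ Quotient.mk _ := rfl
  rw [hr, hq]
  exact (Set.finite_range _).subset (Set.range_comp_subset_range _ _)

theorem center_ne_bot_of_finiteIndex_centralizer [Fact p.Prime] (hG : IsPGroup p G)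
    (hlf : ∀ s : Set G, s.Finite → (Subgroup.closure s : Set G).Finite)
    {g : G} (hg : g ≠ 1) (hfi : (Subgroup.centralizer {g}).FiniteIndex) :
    Subgroup.center G ≠ ⊥ := by
  set K := Subgroup.normalClosure {g} with hK
  have : Finite K := by
    refine (hlf (Group.conjugatesOfSet {g}) ?_).to_subtype
    simpa [Group.conjugatesOfSet] using finite_conjugatesOf hfi
  have hgK : g ∈ K := Subgroup.subset_normalClosure rfl
  have : Nontrivial K := ⟨⟨g, hgK⟩, 1, fun h => hg (congrArg Subtype.val h)⟩
  have hC : IsPGroup p (ConjAct G) := hG.of_equiv ConjAct.toConjAct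
  have hdvd : p ∣ Nat.card K := by
    obtain ⟨n, hn⟩ := (hG.to_subgroup K).exists_card_eq
    rw [hn]
    refine dvd_pow_self p ?_
    rintro rfl
    exact Finite.one_lt_card.ne' hn
  obtain ⟨z, hz, hz1⟩ := hC.exists_fixed_point_of_prime_dvd_card_of_fixed_point K hdvd
    (a := 1) (fun x => smul_one x)
  intro hbot
  have hzc : (z : G) ∈ Subgroup.center G := by
    rw [Subgroup.mem_center_iff]
    intro x
    have := congrArg Subtype.val (hz (ConjAct.toConjAct x))
    rw [ConjAct.Subgroup.val_conj_smul, ConjAct.toConjAct_smul] at this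
    exact mul_inv_eq_iff_eq_mul.1 this
  rw [hbot, Subgroup.mem_bot] at hzc
  exact hz1 (Subtype.ext hzc.symm)

end PGroups

section Transfer

variable {L : FirstOrder.Language.{u, v}} {N : Type w} {N' : Type w'} [L.Structure N]
  [L.Structure N']

theorem forall_realize_iff (h : N ≅[L] N') {α : Type} [Finite α] (φ : L.Formula α) :
    (∀ x : α → N, φ.Realize x) ↔ ∀ x : α → N', φ.Realize x := by
  have := elementarilyEquivalent_iff.1 h ((φ.relabel (Sum.inr : α → Empty ⊕ α)).iAlls α)
  simp only [Sentence.Realize, Formula.realize_iAlls] at this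
  simp only [Formula.realize_relabel] at this
  exact this

theorem exists_realize_iff (h : N ≅[L] N') {α : Type} [Finite α] (φ : L.Formula α) :
    (∃ x : α → N, φ.Realize x) ↔ ∃ x : α → N', φ.Realize x := by
  have := (forall_realize_iff h φ.not).not
  simpa [Formula.realize_not] using this

theorem finite_definable_of_elementarilyEquivalent (h : N ≅[L] N') {α : Type} [Finite α]
    (hfin : {S : Set (α → N) | (∅ : Set N).Definable L S}.Finite) :
    {S : Set (α → N') | (∅ : Set N').Definable L S}.Finite := by
  have := hfin.to_subtype
  rw [← Set.finite_coe_iff]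
  choose φ hφ using fun S : {S : Set (α → N') | (∅ : Set N').Definable L S} =>
    Set.empty_definable_iff.1 S.2
  refine Finite.of_injective (fun S => (⟨Set.ofPred (φ S).Realize,
    Set.empty_definable_iff.2 ⟨_, rfl⟩⟩ : {S : Set (α → N) | (∅ : Set N).Definable L S})) ?_
  intro S S' hSS'
  refine Subtype.ext (Set.ext fun x => ?_)
  rw [hφ S, hφ S']
  have h1 : ∀ x : α → N, ((φ S).iff (φ S')).Realize x := fun x => by
    rw [Formula.realize_iff]
    exact Set.ext_iff.1 (congrArg Subtype.val hSS') x
  exact Formula.realize_iff.1 ((forall_realize_iff h _).1 h1 x)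

end Transfer

section GroupFormulas

variable {L : FirstOrder.Language.{u, v}} (μ : L.Formula (Fin 3)) {α : Type}

/-- If `μ` defines multiplication, this formula says that the variable `a` is the identity. -/
def isOneFormula (a : α) : L.Formula α := μ.relabel ![a, a, a]

/-- If `μ` defines multiplication, this formula says that the variables `a` and `b` commute. -/
noncomputable def commuteFormula (a b : α) : L.Formula α :=
  (μ.relabel ![Sum.inl a, Sum.inl b, Sum.inr ()] ⊓
    μ.relabel ![Sum.inl b, Sum.inl a, Sum.inr ()]).iExs Unit

variable {μ} {N : Type w} [L.Structure N]

/-- The formula `μ` defines the multiplication of the group `N`. -/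
def DefinesMul (μ : L.Formula (Fin 3)) (N : Type w) [L.Structure N] [Group N] : Prop :=
  ∀ x : Fin 3 → N, μ.Realize x ↔ x 0 * x 1 = x 2

section

variable [Group N] (hμ : DefinesMul μ N)
include hμ

theorem DefinesMul.realize_relabel {x : α → N} {a b c : α} :
    (μ.relabel ![a, b, c]).Realize x ↔ x a * x b = x c := by
  rw [Formula.realize_relabel, hμ]
  rfl

theorem DefinesMul.realize_isOne {x : α → N} {a : α} : (isOneFormula μ a).Realize x ↔ x a = 1 := by
  rw [isOneFormula, hμ.realize_relabel, mul_eq_left]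

theorem DefinesMul.realize_commute {x : α → N} {a b : α} :
    (commuteFormula μ a b).Realize x ↔ x a * x b = x b * x a := by
  rw [commuteFormula, Formula.realize_iExs]
  simp only [Formula.realize_inf, hμ.realize_relabel, Sum.elim_inl, Sum.elim_inr]
  exact ⟨fun ⟨z, h1, h2⟩ => h1.trans h2.symm, fun h => ⟨fun _ => x b * x a, h, rfl⟩⟩

end

/-- A structure elementarily equivalent to a group is a group. -/
theorem exists_group_of_elementarilyEquivalent [Group N] (hμ : DefinesMul μ N) {N' : Type w'}
    [L.Structure N'] (h : N ≅[L] N') : ∃ _ : Group N', DefinesMul μ N' := by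
  have relabel : ∀ {β : Type} {x : β → N'} {a b c : β},
      (μ.relabel ![a, b, c]).Realize x ↔ μ.Realize ![x a, x b, x c] := by
    intro β x a b c
    rw [Formula.realize_relabel]
    refine iff_of_eq (congrArg _ ?_)
    funext i
    fin_cases i <;> rfl
  have total : ∀ x y : N', ∃ z, μ.Realize ![x, y, z] := by
    have := (forall_realize_iff h ((μ.relabel ![Sum.inl 0, Sum.inl 1, Sum.inr ()] :
      L.Formula (Fin 2 ⊕ Unit)).iExs Unit)).1 fun x => by
        simp only [Formula.realize_iExs, hμ.realize_relabel]
        exact ⟨fun _ => x 0 * x 1, rfl⟩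
    intro x y
    obtain ⟨z, hz⟩ := Formula.realize_iExs.1 (this ![x, y])
    exact ⟨z (), relabel.1 hz⟩
  have unique : ∀ x y z z' : N', μ.Realize ![x, y, z] → μ.Realize ![x, y, z'] → z = z' := by
    have := (forall_realize_iff h ((μ.relabel ![0, 1, 2]).imp
      ((μ.relabel ![0, 1, 3]).imp (Term.equal (Term.var 2) (Term.var 3))) : L.Formula (Fin 4))).1
        fun x => by
          simp only [Formula.realize_imp, hμ.realize_relabel, Formula.realize_equal,
            Term.realize_var]
          rintro h1 h2
          rw [← h1, ← h2]
    intro x y z z' h1 h2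
    have := this ![x, y, z, z']
    simp only [Formula.realize_imp, relabel, Formula.realize_equal, Term.realize_var] at this
    exact this h1 h2
  have assoc : ∀ x y z s t r : N', μ.Realize ![x, y, s] → μ.Realize ![s, z, t] →
      μ.Realize ![y, z, r] → μ.Realize ![x, r, t] := by
    have := (forall_realize_iff h ((μ.relabel ![0, 1, 3]).imp ((μ.relabel ![3, 2, 4]).imp
      ((μ.relabel ![1, 2, 5]).imp (μ.relabel ![0, 5, 4]))) : L.Formula (Fin 6))).1 fun x => by
        simp only [Formula.realize_imp, hμ.realize_relabel]
        rintro h1 h2 h3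
        rw [← h2, ← h1, ← h3, mul_assoc]
    intro x y z s t r h1 h2 h3
    have := this ![x, y, z, s, t, r]
    simp only [Formula.realize_imp, relabel] at this
    exact this h1 h2 h3
  obtain ⟨e, he⟩ : ∃ e : N', ∀ x, μ.Realize ![e, x, x] ∧ ∃ y, μ.Realize ![y, x, e] := by
    have := (exists_realize_iff h ((μ.relabel ![Sum.inl (), Sum.inr (), Sum.inr ()] ⊓
      (μ.relabel ![Sum.inr (), Sum.inl (Sum.inr ()), Sum.inl (Sum.inl ())] :
        L.Formula ((Unit ⊕ Unit) ⊕ Unit)).iExs Unit).iAlls Unit)).1 ⟨fun _ => 1, by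
        simp only [Formula.realize_iAlls, Formula.realize_inf, hμ.realize_relabel,
          Formula.realize_iExs]
        exact fun x => ⟨one_mul _, fun _ => (x ())⁻¹, inv_mul_cancel _⟩⟩
    obtain ⟨e, he⟩ := this
    refine ⟨e (), fun x => ?_⟩
    have := Formula.realize_iAlls.1 he (fun _ => x)
    rw [Formula.realize_inf, Formula.realize_iExs] at this
    obtain ⟨h1, y, hy⟩ := this
    exact ⟨relabel.1 h1, y (), relabel.1 hy⟩
  choose mul hmul using total
  choose hone inv hinv using he
  have mul_iff : ∀ {x y z}, μ.Realize ![x, y, z] ↔ mul x y = z := fun {x y z} =>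
    ⟨fun h => unique _ _ _ _ (hmul x y) h, fun h => h ▸ hmul x y⟩
  let _ : Mul N' := ⟨mul⟩
  let _ : Inv N' := ⟨inv⟩
  let _ : One N' := ⟨e⟩
  refine ⟨Group.ofLeftAxioms ?_ ?_ ?_, fun x => ?_⟩
  · exact fun x y z => (mul_iff.1 (assoc x y z _ _ _ (hmul _ _) (hmul _ _) (hmul _ _))).symm
  · exact fun x => mul_iff.1 (hone x)
  · exact fun x => mul_iff.1 (hinv x)
  · refine Iff.trans (iff_of_eq (congrArg μ.Realize ?_)) (mul_iff (x := x 0) (y := x 1) (z := x 2))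
    funext i
    fin_cases i <;> rfl

end GroupFormulas

section Saturation

variable {L : FirstOrder.Language.{u, v}} {C : Type w} [L.Structure C]

theorem IsAlephOneSaturated.exists_realize (hsat : IsAlephOneSaturated L C) {A : Set C}
    (hA : A.Countable) (Γ : Set (L.Formula (A ⊕ Unit)))
    (hΓ : ∀ Γ₀ ⊆ Γ, Γ₀.Finite → ∃ c : C, ∀ φ ∈ Γ₀, φ.Realize (Sum.elim (↑) fun _ => c)) :
    ∃ c : C, ∀ φ ∈ Γ, φ.Realize (Sum.elim (↑) fun _ => c) := by
  let e : L[[A]].Formula Unit ≃ L.Formula (A ⊕ Unit) := BoundedFormula.constantsVarsEquiv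
  have he : ∀ (φ : L[[A]].Formula Unit) (c : C),
      (e φ).Realize (Sum.elim (↑) fun _ => c) ↔ φ.Realize fun _ => c := fun φ c =>
    BoundedFormula.realize_constantsVarsEquiv
  obtain ⟨c, hc⟩ := hsat A hA (e ⁻¹' Γ) fun Γ₀ h₀ hfin => by
    obtain ⟨c, hc⟩ := hΓ (e '' Γ₀) (Set.image_subset_iff.2 h₀) (hfin.image e)
    exact ⟨c, fun φ hφ => (he φ c).1 (hc _ ⟨φ, hφ, rfl⟩)⟩
  refine ⟨c, fun φ hφ => ?_⟩
  have := (he (e.symm φ) c).2 (hc _ (by simpa using hφ))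
  simpa using this

/-- In an `ℵ₁`-saturated structure, a countable set of conditions with parameters in a sequence
can be realized if its initial segments can. -/
theorem IsAlephOneSaturated.exists_realize_seq (hsat : IsAlephOneSaturated L C) (a : ℕ → C)
    (ψ : ℕ → L.Formula (ℕ ⊕ Unit))
    (h : ∀ k, ∃ c : C, ∀ i < k, (ψ i).Realize (Sum.elim a fun _ => c)) :
    ∃ c : C, ∀ i, (ψ i).Realize (Sum.elim a fun _ => c) := by
  let r : ℕ ⊕ Unit → Set.range a ⊕ Unit := Sum.map (fun i => ⟨a i, i, rfl⟩) id
  have hr : ∀ c : C, Sum.elim ((↑) : Set.range a → C) (fun _ : Unit => c) ∘ r =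
      Sum.elim a fun _ => c := by
    intro c
    funext i
    rcases i with i | i <;> rfl
  obtain ⟨c, hc⟩ := hsat.exists_realize (Set.countable_range a)
    (Set.range fun i => (ψ i).relabel r) fun Γ₀ h₀ hfin => by
      choose f hf using fun φ : Γ₀ => h₀ φ.2
      have := hfin.to_subtype
      obtain ⟨k, hk⟩ := (Set.finite_range f).bddAbove
      obtain ⟨c, hc⟩ := h (k + 1)
      refine ⟨c, fun φ hφ => ?_⟩
      have h1 := hc (f ⟨φ, hφ⟩) (Nat.lt_succ_of_le (hk ⟨_, rfl⟩))
      have h2 := hf ⟨φ, hφ⟩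
      simp only at h2
      rw [← h2, Formula.realize_relabel, hr]
      exact h1
  refine ⟨c, fun i => ?_⟩
  have := hc _ ⟨i, rfl⟩
  rwa [Formula.realize_relabel, hr] at this

end Saturation

namespace GlobalType

variable {L : FirstOrder.Language.{u, v}} {C : Type w} [L.Structure C] (q : GlobalType L C)

/-- A global type is realized in an elementary extension. -/
theorem exists_realization : ∃ (N : Type (max u v w)) (_ : L.Structure N) (j : C ↪ₑ[L] N) (d : N),
    ∀ (m : ℕ) (φ : L.Formula (Fin m ⊕ Unit)) (b : Fin m → C),
      q.Contains φ b ↔ φ.Realize (Sum.elim (j ∘ b) fun _ => d) := by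
  obtain ⟨N, d, hd⟩ := exists_isRealizedBy q
  let _ : L.Structure N := (L.lhomWithConstants C).reduct N
  have : (L.lhomWithConstants C).IsExpansionOn N := LHom.isExpansionOn_reduct _ _
  refine ⟨N, inferInstance, ElementaryEmbedding.ofModelsElementaryDiagram L C N, d (),
    fun m φ b => ?_⟩
  rw [Contains, hd]
  have h := BoundedFormula.realize_constantsVarsEquiv (M := N) (xs := (default : Fin 0 → N)) (v := d)
    (φ := BoundedFormula.constantsVarsEquiv.symm (φ.relabel (Sum.map b id)))
  rw [Equiv.apply_symm_apply] at h
  refine h.symm.trans (Formula.realize_relabel.trans (iff_of_eq (congrArg φ.Realize ?_)))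
  funext i
  rcases i with i | i <;> rfl

variable {q}

theorem contains_not {m : ℕ} {φ : L.Formula (Fin m ⊕ Unit)} {b : Fin m → C} :
    q.Contains φ.not b ↔ ¬ q.Contains φ b := by
  obtain ⟨N, _, j, d, h⟩ := q.exists_realization
  rw [h, h, Formula.realize_not]

theorem RealizesOver.mono {A B : Set C} {c : C} (h : q.RealizesOver B c) (hAB : A ⊆ B) :
    q.RealizesOver A c := fun m φ b hb => h m φ b fun i => hAB (hb i)

variable (q) in
theorem exists_realizesOver (hsat : IsAlephOneSaturated L C) {B : Set C} (hB : B.Countable) :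
    ∃ c, q.RealizesOver B c := by
  obtain ⟨N, _, j, d, h⟩ := q.exists_realization
  obtain ⟨c, hc⟩ := hsat.exists_realize hB
    {φ | φ.Realize (Sum.elim (fun i => j i) fun _ => d)} fun Γ₀ h₀ hfin => by
      have := hfin.to_subtype
      have h1 : ((Formula.iInf fun φ : Γ₀ => φ.1).iExs Unit).Realize (fun i : B => j i) := by
        rw [Formula.realize_iExs]
        exact ⟨fun _ => d, Formula.realize_iInf.2 fun φ => h₀ φ.2⟩
      have h2 := (j.map_formula _ _).1 h1
      obtain ⟨c, hc⟩ := Formula.realize_iExs.1 h2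
      exact ⟨c (), fun φ hφ => Formula.realize_iInf.1 hc ⟨φ, hφ⟩⟩
  refine ⟨c, fun m φ b hb hφ => ?_⟩
  have h1 := hc (φ.relabel (Sum.map (fun i => ⟨b i, hb i⟩) id)) (by
    refine Formula.realize_relabel.2 ?_
    refine (iff_of_eq (congrArg φ.Realize ?_)).1 ((h m φ b).1 hφ)
    funext i
    rcases i with i | i <;> rfl)
  refine (iff_of_eq (congrArg φ.Realize ?_)).1 (Formula.realize_relabel.1 h1)
  funext i
  rcases i with i | i <;> rfl

variable (q) in
theorem exists_isMorleySequence (hsat : IsAlephOneSaturated L C) {B : Set C} (hB : B.Countable) :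
    ∃ a : ℕ → C, q.IsMorleySequence B a := by
  choose r hr using fun l : List C => q.exists_realizesOver hsat
    (hB.union l.finite_toSet.countable)
  let F : ℕ → List C := fun n => Nat.rec [] (fun _ l => r l :: l) n
  refine ⟨fun n => r (F n), fun n => (hr (F n)).mono (Set.union_subset_union_right _ ?_)⟩
  rintro _ ⟨i, hi, rfl⟩
  have hi : i < n := hi
  induction n with
  | zero => omega
  | succ n ih =>
    rcases Nat.lt_succ_iff_lt_or_eq.1 hi with hi | rfl
    · exact List.mem_cons_of_mem _ (ih hi hi)
    · exact List.mem_cons_self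

/-- A formula holding along a Morley sequence of a generically stable type is in the type. -/
theorem IsGenericallyStableOver.contains_of_forall_realize (hgs : q.IsGenericallyStableOver ∅)
    (hsat : IsAlephOneSaturated L C) {a : ℕ → C} (ha : q.IsMorleySequence ∅ a) {m : ℕ}
    {φ : L.Formula (Fin m ⊕ Unit)} {b : Fin m → C}
    (h : ∀ i, φ.Realize (Sum.elim b fun _ => a i)) : q.Contains φ b := by
  by_contra hφ
  obtain ⟨a', ha'⟩ := q.exists_isMorleySequence hsat
    ((Set.countable_range a).union (Set.countable_range b))
  have hn : ∀ i, ¬ φ.Realize (Sum.elim b fun _ => a' i) := fun i =>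
    Formula.realize_not.1 (ha' i m φ.not b (fun k => Or.inl (Or.inr ⟨k, rfl⟩)) (contains_not.2 hφ))
  let s : ℕ ⊕ₗ ℕ → C := fun i => Sum.elim a a' (ofLex i)
  have hs : q.IsMorleySequence ∅ s := by
    rintro (i | i)
    · refine (ha i).mono (Set.union_subset_union_right _ ?_)
      rintro _ ⟨k | k, hk, rfl⟩
      · exact ⟨k, Sum.Lex.inl_lt_inl_iff.1 hk, rfl⟩
      · exact absurd hk Sum.Lex.not_inr_lt_inl
    · refine (ha' i).mono (Set.union_subset (Set.empty_subset _) ?_)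
      rintro _ ⟨k | k, hk, rfl⟩
      · exact Or.inl (Or.inl ⟨k, rfl⟩)
      · exact Or.inr ⟨k, Sum.Lex.inr_lt_inr_iff.1 hk, rfl⟩
  have hwf : WellFoundedLT (ℕ ⊕ₗ ℕ) := ⟨Sum.lex_wf wellFounded_lt wellFounded_lt⟩
  rcases hgs.2 (ℕ ⊕ₗ ℕ) s hs m φ b with hfin | hfin
  · refine (Set.infinite_range_of_injective (f := fun i : ℕ => (toLex (Sum.inl i) : ℕ ⊕ₗ ℕ))
      fun i k hik => by simpa using hik) (hfin.subset ?_)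
    rintro _ ⟨i, rfl⟩
    exact h i
  · refine (Set.infinite_range_of_injective (f := fun i : ℕ => (toLex (Sum.inr i) : ℕ ⊕ₗ ℕ))
      fun i k hik => by simpa using hik) (hfin.subset ?_)
    rintro _ ⟨i, rfl⟩
    exact hn i

/-- If there are finitely many `∅`-definable sets in `m` variables, then a formula has a definition
over `∅` with respect to an `∅`-invariant type. -/
theorem IsInvariantOver.definable_setOf_contains (hq : q.IsInvariantOver ∅) {m : ℕ}
    (hfin : {S : Set (Fin m → C) | (∅ : Set C).Definable L S}.Finite)
    (φ : L.Formula (Fin m ⊕ Unit)) : (∅ : Set C).Definable L {b | q.Contains φ b} := by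
  have hdef : ∀ 𝒟 ⊆ {S : Set (Fin m → C) | (∅ : Set C).Definable L S},
      (∅ : Set C).Definable L (⋃₀ 𝒟) := by
    intro 𝒟 h𝒟
    have := (hfin.subset h𝒟).to_subtype
    rw [Set.sUnion_eq_iUnion]
    exact Set.definable_iUnion_of_finite fun S => h𝒟 S.2
  have hatom : ∀ b : Fin m → C, (∅ : Set C).Definable L
      (⋂₀ {S | (∅ : Set C).Definable L S ∧ b ∈ S}) := by
    intro b
    have := (hfin.subset (t := {S | (∅ : Set C).Definable L S ∧ b ∈ S})
      fun S hS => hS.1).to_subtype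
    rw [Set.sInter_eq_iInter]
    exact Set.definable_iInter_of_finite fun S => S.2.1
  have heq : {b | q.Contains φ b} =
      ⋃₀ ((fun b => ⋂₀ {S | (∅ : Set C).Definable L S ∧ b ∈ S}) '' {b | q.Contains φ b}) := by
    ext b
    constructor
    · intro hb
      exact ⟨_, ⟨b, hb, rfl⟩, fun S hS => hS.2⟩
    · rintro ⟨_, ⟨b', hb', rfl⟩, hb⟩
      refine (hq m b' b (fun ψ => ⟨fun h => ?_, fun h => ?_⟩) φ).1 hb'
      · exact hb {x | ψ.Realize x} ⟨⟨ψ, rfl⟩, h⟩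
      · by_contra hn
        exact hb {x | ψ.not.Realize x} ⟨⟨ψ.not, rfl⟩, Formula.realize_not.2 hn⟩ h
  rw [heq]
  refine hdef _ ?_
  rintro _ ⟨b, _, rfl⟩
  exact hatom b

end GlobalType

section DefinableGroups

variable {L : FirstOrder.Language.{u, v}} {μ : L.Formula (Fin 3)} {G : Type w} [Group G]
  [L.Structure G] {C : Type w'} [Group C] [L.Structure C]

theorem DefinesMul.map_mul (hG : DefinesMul μ G) (hC : DefinesMul μ C) {f : G → C}
    (hf : ∀ x : Fin 3 → G, μ.Realize (f ∘ x) ↔ μ.Realize x) (x y : G) :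
    f (x * y) = f x * f y :=
  ((hC _).1 ((hf ![x, y, x * y]).2 ((hG _).2 rfl))).symm

theorem center_eq_bot_or_eq_top (hsimple : IsCharacteristicallySimple L G) (hμ : DefinesMul μ G) :
    Subgroup.center G = ⊥ ∨ Subgroup.center G = ⊤ := by
  refine hsimple _ fun σ x hx => Subgroup.mem_center_iff.2 fun y => ?_
  have hσ := hμ.map_mul hμ (f := σ) fun x => StrongHomClass.realize_formula σ μ
  obtain ⟨z, rfl⟩ := σ.toEquiv.surjective y
  change σ z * σ x = σ x * σ z
  rw [← hσ, ← hσ, Subgroup.mem_center_iff.1 hx]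

/-- The transfer along elementary equivalence of a definable subgroup. -/
theorem exists_subgroup_realize (hG : DefinesMul μ G) (hC : DefinesMul μ C) (h : G ≅[L] C)
    {θ : L.Formula (Fin 1)} {H : Subgroup C} (hθ : ∀ x : Fin 1 → C, θ.Realize x ↔ x 0 ∈ H) :
    ∃ K : Subgroup G, ∀ x : Fin 1 → G, θ.Realize x ↔ x 0 ∈ K := by
  have hrel : ∀ {n : ℕ} {x : Fin n → C} {i : Fin n}, (θ.relabel ![i]).Realize x ↔ x i ∈ H := by
    intro n x i
    rw [Formula.realize_relabel, hθ]
    rfl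
  have hconst : ∀ x : Fin 1 → G, (fun _ => x 0) = x := fun x => by
    funext i
    rw [Subsingleton.elim i 0]
  have hrel' : ∀ {n : ℕ} {x : Fin n → G} {i : Fin n},
      (θ.relabel ![i]).Realize x ↔ θ.Realize fun _ => x i := by
    intro n x i
    rw [Formula.realize_relabel, ← hconst (x ∘ ![i])]
    rfl
  refine ⟨{ carrier := {g | θ.Realize fun _ => g}, mul_mem' := ?_, one_mem' := ?_, inv_mem' := ?_ },
    fun x => ?_⟩
  · have := (forall_realize_iff h ((θ.relabel ![0]).imp ((θ.relabel ![1]).imp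
      ((μ.relabel ![0, 1, 2]).imp (θ.relabel ![2]))) : L.Formula (Fin 3))).2 fun x => by
        simp only [Formula.realize_imp, hrel, hC.realize_relabel]
        exact fun h0 h1 h2 => h2 ▸ H.mul_mem h0 h1
    intro x y hx hy
    have := this ![x, y, x * y]
    simp only [Formula.realize_imp, hrel', hG.realize_relabel] at this
    exact this hx hy rfl
  · have := (forall_realize_iff h ((isOneFormula μ 0).imp (θ.relabel ![0]) : L.Formula (Fin 1))).2
      fun x => by
        simp only [Formula.realize_imp, hrel, hC.realize_isOne]
        exact fun h0 => h0 ▸ H.one_mem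
    have := this ![1]
    simp only [Formula.realize_imp, hrel', hG.realize_isOne] at this
    exact this rfl
  · have := (forall_realize_iff h ((θ.relabel ![0]).imp ((μ.relabel ![0, 1, 2]).imp
      ((isOneFormula μ 2).imp (θ.relabel ![1]))) : L.Formula (Fin 3))).2 fun x => by
        simp only [Formula.realize_imp, hrel, hC.realize_relabel, hC.realize_isOne]
        intro h0 h1 h2
        rw [h2] at h1
        exact (inv_eq_of_mul_eq_one_right h1) ▸ H.inv_mem h0
    intro x hx
    have := this ![x, x⁻¹, 1]
    simp only [Formula.realize_imp, hrel', hG.realize_relabel, hG.realize_isOne] at this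
    exact this hx (mul_inv_cancel x) rfl
  · exact iff_of_eq (congrArg θ.Realize (hconst x).symm)

/-- The elements of a group commuting with a realization of a global type form a subgroup. -/
theorem exists_subgroup_contains_commute (hC : DefinesMul μ C) (q : GlobalType L C) :
    ∃ H : Subgroup C, ∀ b : Fin 1 → C,
      q.Contains (commuteFormula μ (Sum.inl 0) (Sum.inr ())) b ↔ b 0 ∈ H := by
  obtain ⟨N, _, j, d, h⟩ := q.exists_realization
  obtain ⟨_, hN⟩ := exists_group_of_elementarilyEquivalent hC j.elementarilyEquivalent
  let f : C →* N := MonoidHom.mk' j (hC.map_mul hN fun x => j.map_formula μ x)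
  refine ⟨(Subgroup.centralizer {d}).comap f, fun b => ?_⟩
  rw [h, hN.realize_commute, Subgroup.mem_comap, Subgroup.mem_centralizer_singleton_iff]
  rfl

theorem DefinesMul.contains_not_isOne (hC : DefinesMul μ C) {q : GlobalType L C}
    (hq : q.IsNonAlgebraic) (b : Fin 0 → C) : q.Contains (isOneFormula μ (Sum.inr ())).not b := by
  rw [GlobalType.contains_not]
  intro h
  refine hq 0 _ b h ((Set.finite_singleton (1 : C)).subset fun c hc => ?_)
  exact hC.realize_isOne.1 hc

theorem exists_finiteIndex_centralizer {k : ℕ} {x : Fin k → G}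
    (h : ∀ g, ∃ i, x i * g = g * x i) : ∃ i, (Subgroup.centralizer {x i}).FiniteIndex := by
  obtain ⟨i, -, hi⟩ := Subgroup.exists_finiteIndex_of_leftCoset_cover (s := Finset.univ)
    (g := fun _ : Fin k => (1 : G)) (H := fun i => Subgroup.centralizer {x i}) (by
      refine Set.eq_univ_of_forall fun g => ?_
      obtain ⟨i, hi⟩ := h g
      simp only [Set.mem_iUnion]
      exact ⟨i, Finset.mem_univ i, g, Subgroup.mem_centralizer_singleton_iff.2 hi.symm, one_mul g⟩)
  exact ⟨i, hi⟩

end DefinableGroups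

end OmegaCat

theorem mainTheorem3
    (p : ℕ) (hp : p.Prime)
    -- an ω-categorical structure `M` with NIP
    (L : FirstOrder.Language.{u, v}) (M : Type w) [L.Structure M]
    (hcat : OmegaCat.IsOmegaCategorical L M) (hnip : OmegaCat.HasNIP L M)
    -- a group `G`, with a structure in which its multiplication is definable, interpretable in `M`
    (L' : FirstOrder.Language.{u', v'}) (G : Type w') [Group G] [L'.Structure G]
    (hmul : (∅ : Set G).Definable L' {x : Fin 3 → G | x 0 * x 1 = x 2})
    (hint : OmegaCat.IsInterpretable L M L' G)
    (hG : IsPGroup p G) (hsimple : OmegaCat.IsCharacteristicallySimple L' G)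
    -- a saturated model `C` of the theory of `G`, and a global type over it
    (C : Type*) [L'.Structure C] (hC : G ≅[L'] C) (hsat : OmegaCat.IsAlephOneSaturated L' C)
    (q : OmegaCat.GlobalType L' C) (hq : q.IsNonAlgebraic)
    (hgs : q.IsGenericallyStableOver ∅) :
    ∀ x y : G, x * y = y * x := by
  open OmegaCat in
  have : Fact p.Prime := ⟨hp⟩
  have hfin : ∀ n : ℕ, {S : Set (Fin n → G) | (∅ : Set G).Definable L' S}.Finite :=
    hint.finite_definable hcat.finite_definable
  have hlf := fun s : Set G => finite_closure_of_finite_definable hmul hfin (s := s)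
  obtain ⟨μ, hμ⟩ := Set.empty_definable_iff.1 hmul
  have hμG : DefinesMul μ G := fun x => (Set.ext_iff.1 hμ x).symm
  obtain ⟨_, hμC⟩ := exists_group_of_elementarilyEquivalent hμG hC
  rcases center_eq_bot_or_eq_top hsimple hμG with hZ | hZ
  swap
  · exact fun x y => (Subgroup.mem_center_iff.1 (hZ ▸ Subgroup.mem_top x) y).symm
  rcases subsingleton_or_nontrivial G with _ | _
  · exact fun x y => Subsingleton.elim _ _
  exfalso
  obtain ⟨a, ha⟩ := q.exists_isMorleySequence hsat Set.countable_empty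
  obtain ⟨H, hH⟩ := exists_subgroup_contains_commute hμC q
  obtain ⟨θ, hθ⟩ := Set.empty_definable_iff.1 (hgs.1.definable_setOf_contains
    (finite_definable_of_elementarilyEquivalent hC (hfin 1))
    (commuteFormula μ (Sum.inl 0) (Sum.inr ())))
  have hθH : ∀ x : Fin 1 → C, θ.Realize x ↔ x 0 ∈ H := fun x =>
    (Set.ext_iff.1 hθ x).symm.trans (hH x)
  obtain ⟨K, hK⟩ := exists_subgroup_realize hμG hμC hC hθH
  rcases hsimple K fun σ x hx => (hK fun _ => σ x).1
    ((StrongHomClass.realize_formula σ θ (v := fun _ => x)).2 ((hK fun _ => x).2 hx)) with hbot | htop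
  · -- nontrivial elements commute with only finitely many terms of the Morley sequence
    have hH1 : ∀ g ∈ H, g = 1 := by
      have := (forall_realize_iff hC (θ.imp (isOneFormula μ 0))).1 fun x => by
        rw [Formula.realize_imp, hK, hμG.realize_isOne, hbot]
        exact Subgroup.mem_bot.1
      intro g hg
      have := this fun _ => g
      rw [Formula.realize_imp, hθH, hμC.realize_isOne] at this
      exact this hg
    have hcomm : ∀ k : ℕ, ∀ x : Fin k → C, ∃ g : C, g ≠ 1 ∧ ∀ i, x i * g = g * x i := by
      intro k
      have := (forall_realize_iff hC (((isOneFormula μ (Sum.inr ())).not ⊓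
        Formula.iInf fun i => commuteFormula μ (Sum.inl i) (Sum.inr ()) :
          L'.Formula (Fin k ⊕ Unit)).iExs Unit)).1 fun x => by
          obtain ⟨g, hg, hx⟩ := exists_ne_one_forall_commute_of_locallyFinite hG hlf
            (Set.finite_range x)
          simp only [Formula.realize_iExs, Formula.realize_inf, Formula.realize_not,
            hμG.realize_isOne, Formula.realize_iInf, hμG.realize_commute]
          exact ⟨fun _ => g, hg, fun i => hx _ ⟨i, rfl⟩⟩
      intro x
      have := this x
      simp only [Formula.realize_iExs, Formula.realize_inf, Formula.realize_not,
        hμC.realize_isOne, Formula.realize_iInf, hμC.realize_commute] at this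
      obtain ⟨g, hg, hx⟩ := this
      exact ⟨g (), hg, hx⟩
    obtain ⟨c, hc⟩ := hsat.exists_realize_seq a (fun i => (isOneFormula μ (Sum.inr ())).not ⊓
      commuteFormula μ (Sum.inl i) (Sum.inr ())) fun k => by
        obtain ⟨g, hg, hx⟩ := hcomm k fun i => a i
        refine ⟨g, fun i hi => ?_⟩
        rw [Formula.realize_inf, Formula.realize_not, hμC.realize_isOne, hμC.realize_commute]
        exact ⟨hg, hx ⟨i, hi⟩⟩
    simp only [Formula.realize_inf, Formula.realize_not, hμC.realize_isOne,
      hμC.realize_commute, Sum.elim_inl, Sum.elim_inr] at hc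
    refine (hc 0).1 (hH1 c ((hH fun _ => c).1 (hgs.contains_of_forall_realize hsat ha fun i => ?_)))
    exact hμC.realize_commute.2 (hc i).2.symm
  · -- the centralizers of finitely many terms of the Morley sequence cover the group
    have hHtop : ∀ g : C, g ∈ H := by
      have := (forall_realize_iff hC θ).1 fun x => (hK x).2 (htop ▸ Subgroup.mem_top _)
      exact fun g => (hθH fun _ => g).1 (this _)
    have hcover : ∃ k : ℕ, ∀ g : C, ∃ i < k, a i * g = g * a i := by
      by_contra! hcon
      obtain ⟨c, hc⟩ := hsat.exists_realize_seq a
        (fun i => (commuteFormula μ (Sum.inl i) (Sum.inr ())).not) fun k => by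
          obtain ⟨g, hg⟩ := hcon k
          refine ⟨g, fun i hi => ?_⟩
          rw [Formula.realize_not, hμC.realize_commute]
          exact hg i hi
      simp only [Formula.realize_not, hμC.realize_commute, Sum.elim_inl, Sum.elim_inr] at hc
      refine GlobalType.contains_not.1 (hgs.contains_of_forall_realize hsat ha (b := fun _ => c)
        fun i => ?_) ((hH _).2 (hHtop c))
      rw [Formula.realize_not, hμC.realize_commute]
      exact fun h => hc i h.symm
    obtain ⟨k, hk⟩ := hcover
    have ha1 : ∀ i, a i ≠ 1 := fun i h => by
      have := ha i 0 _ Fin.elim0 (fun i => i.elim0) (hμC.contains_not_isOne hq _)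
      rw [Formula.realize_not, hμC.realize_isOne] at this
      exact this h
    obtain ⟨x, hx⟩ := (exists_realize_iff hC ((Formula.iInf fun i => (isOneFormula μ i).not) ⊓
      (Formula.iSup fun i => commuteFormula μ (Sum.inl i) (Sum.inr ()) :
        L'.Formula (Fin k ⊕ Unit)).iAlls Unit)).2 ⟨fun i => a i, by
          simp only [Formula.realize_inf, Formula.realize_iInf, Formula.realize_not,
            hμC.realize_isOne, Formula.realize_iAlls, Formula.realize_iSup, hμC.realize_commute]
          refine ⟨fun i => ha1 i, fun g => ?_⟩
          obtain ⟨i, hi, h⟩ := hk (g ())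
          exact ⟨⟨i, hi⟩, h⟩⟩
    simp only [Formula.realize_inf, Formula.realize_iInf, Formula.realize_not,
      hμG.realize_isOne, Formula.realize_iAlls, Formula.realize_iSup, hμG.realize_commute] at hx
    obtain ⟨i, hi⟩ := exists_finiteIndex_centralizer fun g => hx.2 fun _ => g
    exact center_ne_bot_of_finiteIndex_centralizer hG hlf (hx.1 i) hi hZ
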